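/- For every integer $n\ge 1$, let $n$ coins weighing $1,2,\dots,n$ grams be given. The Baron knows which coin weighs how much; the audience knows only that the weights are $1,\dots,n$ in some order. In a weighing on a balance scale the Baron places two disjoint sets of coins on the two cups, and the audience sees which coins lie on which cup and whether the left cup is lighter, equal in weight, or heavier. A sequence of weighings demonstrates the weight of a coin if every assignment of the weights $1,\dots,n$ to the coins that is consistent with all the observed outcomes gives that coin the same weight. Let $a(n)$ be the minimum number of weighings with which the Baron can demonstrate the weight of at least one coin (Baron Münchhausen's sequence). Then $a(n)\le 2$. Moreover, the weight of the $n$-gram coin can always be demonstrated with at most two weighings. -/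

import Mathlib

namespace Munchhausen

/-- An assignment of weights to `n` coins: the coins are the elements of `Fin n`, and their weights
are `1, 2, …, n` grams in some order. The audience knows only that the true assignment is one of
these. -/
abbrev Assignment (n : ℕ) := Fin n ≃ Finset.Icc 1 n

/-- A weighing of `n` coins on a balance scale: some coins go on the left cup, some other coins go
on the right cup, and the remaining coins stay off the scale. -/
structure Weighing (n : ℕ) where
  left : Finset (Fin n)
  right : Finset (Fin n)
  disj : Disjoint left right

/-- What the scale shows: the left cup is lighter (`lt`), the cups balance (`eq`), or the left cup
is heavier (`gt`). -/
def Weighing.outcome {n : ℕ} (W : Weighing n) (w : Assignment n) : Ordering :=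
  cmp (∑ c ∈ W.left, (w c : ℕ)) (∑ c ∈ W.right, (w c : ℕ))

/-- If `w` is the true assignment, conducting the weighings `Ws` demonstrates the weight of the
coin `c`: every assignment for which the scale would have shown the same outcomes gives `c` its
true weight. -/
def Demonstrates {n : ℕ} (w : Assignment n) (Ws : List (Weighing n)) (c : Fin n) : Prop :=
  ∀ w' : Assignment n, (∀ W ∈ Ws, W.outcome w' = W.outcome w) → w' c = w c

/-- `k` weighings suffice: whatever the true assignment, the Baron, who knows it, can choose `k`
weighings that demonstrate the weight of at least one coin. -/
def Suffices (n k : ℕ) : Prop :=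
  ∀ w : Assignment n, ∃ Ws : List (Weighing n), Ws.length = k ∧ ∃ c : Fin n, Demonstrates w Ws c

/-- Baron Münchhausen's sequence: the minimum number of weighings that suffice for `n` coins
(`⊤` if no number of weighings did). -/
noncomputable def a (n : ℕ) : ℕ∞ :=
  ⨅ (k : ℕ) (_ : Suffices n k), (k : ℕ∞)

end Munchhausen

/-! Two weighings that both balance suffice for n ≠ 2. Give each coin the coefficient 1, -1 or 0 in
each weighing, according to its cup. If the total coefficient never increases with the weight, the
true assignment minimises the sum of total coefficient times weight, by the rearrangement
inequality. Any consistent assignment has the same sum 0, so it is also a minimiser and must give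
weight n to the coin whose total coefficient is strictly least.

Such coefficients come from Gauss's Eureka theorem. Write T_k = k(k+1)/2 and T_n + n = T_p + T_q +
T_r with p ≤ q ≤ r ≤ n. The total [k ≤ p] + [k ≤ q] + [k ≤ r] - 1 - [k = n] is then monotone,
strictly least at n, and has weighted sum 0. It remains to split it into two balanced weighings with
coefficients in {-1, 0, 1}. This is a subset-sum problem in the interval (p, n), solvable apart from
a few configurations treated by hand.

The Eureka theorem is reduced to sums of three squares for m ≡ 3 mod 8, which is proved in Ankeny's
way: Minkowski's theorem, Dirichlet's theorem and the two-squares theorem. -/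

open MeasureTheory

/-! ### Three squares and three triangular numbers -/

/-- Minkowski's theorem for an ellipsoid in dimension three. -/
theorem exists_int_vec_sum_sq_mulVec_lt (A : Matrix (Fin 3) (Fin 3) ℝ) (r : ℝ) (hr : 0 < r)
    (hA : A.det ≠ 0) (h : 8 * |A.det| < r ^ 3 * (Real.pi * 4 / 3)) :
    ∃ v : Fin 3 → ℤ, v ≠ 0 ∧ ∑ i, (A.mulVec (fun i => (v i : ℝ)) i) ^ 2 < r ^ 2 := by
  classical
  set B : Set (Fin 3 → ℝ) := WithLp.toLp 2 ⁻¹' Metric.ball (0 : EuclideanSpace ℝ (Fin 3)) r with hB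
  have memB : ∀ x, x ∈ B ↔ ∑ i, x i ^ 2 < r ^ 2 := by
    intro x
    rw [hB, Set.mem_preimage, mem_ball_zero_iff, EuclideanSpace.norm_eq,
      Real.sqrt_lt' hr]
    simp
  have volB : volume B = ENNReal.ofReal (r ^ 3 * (Real.pi * 4 / 3)) := by
    rw [hB, (PiLp.volume_preserving_toLp (Fin 3)).measure_preimage
      measurableSet_ball.nullMeasurableSet, EuclideanSpace.volume_ball_fin_three,
      ENNReal.ofReal_mul (by positivity), ENNReal.ofReal_pow hr.le]
  have convB : Convex ℝ B := by
    have : Convex ℝ ((WithLp.linearEquiv 2 ℝ (Fin 3 → ℝ)).symm.toLinearMap ⁻¹'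
        Metric.ball (0 : EuclideanSpace ℝ (Fin 3)) r) :=
      (convex_ball _ _).linear_preimage _
    exact this
  set s : Set (Fin 3 → ℝ) := Matrix.toLin' A ⁻¹' B with hs
  have hdet : LinearMap.det (Matrix.toLin' A) ≠ 0 := by rwa [LinearMap.det_toLin']
  have vols : volume s = ENNReal.ofReal (|A.det|⁻¹ * (r ^ 3 * (Real.pi * 4 / 3))) := by
    rw [hs, Measure.addHaar_preimage_linearMap _ hdet, volB, LinearMap.det_toLin', abs_inv,
      ← ENNReal.ofReal_mul (by positivity)]
  have hF := ZSpan.isAddFundamentalDomain (Pi.basisFun ℝ (Fin 3)) volume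
  have hvolF : volume (ZSpan.fundamentalDomain (Pi.basisFun ℝ (Fin 3))) = 1 := by
    rw [ZSpan.volume_fundamentalDomain]
    have : Matrix.of (⇑(Pi.basisFun ℝ (Fin 3))) = (1 : Matrix (Fin 3) (Fin 3) ℝ) := by
      ext i j
      simp [Matrix.one_apply, Pi.single_apply, eq_comm]
    rw [this]; simp
  have : Countable (Submodule.span ℤ (Set.range ⇑(Pi.basisFun ℝ (Fin 3)))).toAddSubgroup :=
    inferInstanceAs (Countable (Submodule.span ℤ (Set.range ⇑(Pi.basisFun ℝ (Fin 3)))))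
  have hpos : 0 < |A.det| := abs_pos.mpr hA
  obtain ⟨⟨x, hx⟩, hx0, hxs⟩ := exists_ne_zero_mem_lattice_of_measure_mul_two_pow_lt_measure
    (L := (Submodule.span ℤ (Set.range ⇑(Pi.basisFun ℝ (Fin 3)))).toAddSubgroup) (s := s) hF
    (by
      intro x hx
      rw [hs, Set.mem_preimage, memB] at hx ⊢
      simpa [Matrix.mulVec_neg] using hx)
    (convB.linear_preimage _)
    (by
      rw [hvolF, vols, one_mul, Module.finrank_fin_fun,
        show (2 : ENNReal) ^ 3 = ENNReal.ofReal 8 by norm_num,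
        ENNReal.ofReal_lt_ofReal_iff (by positivity), inv_mul_eq_div, lt_div_iff₀ hpos]
      exact h)
  have hx' : x ∈ Submodule.span ℤ (Set.range ⇑(Pi.basisFun ℝ (Fin 3))) := hx
  rw [Module.Basis.mem_span_iff_repr_mem] at hx'
  choose v hv using hx'
  have hxv : x = fun i => (v i : ℝ) := by
    funext i
    have := hv i
    simp at this
    exact this.symm
  refine ⟨v, ?_, ?_⟩
  · rintro rfl
    apply hx0
    ext i
    simp [hxv]
  · rw [hs, Set.mem_preimage, memB] at hxs
    simpa [hxv, Matrix.toLin'_apply] using hxs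

/-- The ellipsoid `(2qx+by+mz)² + 2(qx²+bxy+hy²) < 2m` contains a nonzero integer point. -/
theorem exists_int_ternary_lt (m q b h : ℤ) (hm : 0 < m) (hq : 0 < q)
    (hb : b ^ 2 + m = 4 * q * h) :
    ∃ x y z : ℤ, ¬ (x = 0 ∧ y = 0 ∧ z = 0) ∧
      (2 * q * x + b * y + m * z) ^ 2 + 2 * (q * x ^ 2 + b * x * y + h * y ^ 2) < 2 * m := by
  have hmR : (0 : ℝ) < m := by exact_mod_cast hm
  have hqR : (0 : ℝ) < q := by exact_mod_cast hq
  set u : ℝ := √(2 * q) with hu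
  have hu0 : 0 < u := Real.sqrt_pos.mpr (by positivity)
  have hu2 : u ^ 2 = 2 * q := Real.sq_sqrt (by positivity)
  set w : ℝ := √m with hw
  have hw0 : 0 < w := Real.sqrt_pos.mpr hmR
  have hw2 : w ^ 2 = m := Real.sq_sqrt hmR.le
  set t : ℝ := √2
  have ht0 : 0 < t := Real.sqrt_pos.mpr (by norm_num)
  have ht2 : t ^ 2 = 2 := Real.sq_sqrt (by norm_num)
  have hbR : (b : ℝ) ^ 2 + m = 4 * q * h := by exact_mod_cast hb
  -- The rows are chosen so that the squared norm of the image is the form in the goal. Completing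
  -- the square in the binary part uses `b ^ 2 + m = 4 * q * h`.
  set A : Matrix (Fin 3) (Fin 3) ℝ := !![2 * q, b, m; u, b / u, 0; 0, w / u, 0] with hAdef
  have hdet : A.det = m * w := by
    rw [hAdef, Matrix.det_fin_three]
    simp
    field_simp
  obtain ⟨v, hv0, hv⟩ := exists_int_vec_sum_sq_mulVec_lt A (t * w) (by positivity)
    (by rw [hdet]; positivity) (by
      rw [hdet, abs_of_pos (by positivity)]
      have h1 : (t * w) ^ 3 = 2 * t * (m * w) := by
        rw [← hw2]
        linear_combination t * w ^ 3 * ht2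
      rw [h1]
      -- The volume condition reduces to 3 < √2 π.
      have h2 : (1.4 : ℝ) < t := Real.lt_sqrt_of_sq_lt (by norm_num)
      have h3 := Real.pi_gt_d2
      have h4 : 0 < (m : ℝ) * w := by positivity
      have h5 : (1.4 : ℝ) * 3.14 < t * Real.pi := by gcongr
      nlinarith)
  refine ⟨v 0, v 1, v 2, ?_, ?_⟩
  · rintro ⟨h0, h1, h2⟩
    apply hv0
    funext i
    fin_cases i <;> simpa
  · have key : ∑ i, (A.mulVec (fun i => (v i : ℝ)) i) ^ 2 =
        (2 * q * v 0 + b * v 1 + m * v 2) ^ 2 +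
          2 * (q * v 0 ^ 2 + b * v 0 * v 1 + h * v 1 ^ 2) := by
      have e1 : (u * v 0 + b / u * v 1) ^ 2 + (w / u * v 1) ^ 2 =
          2 * (q * v 0 ^ 2 + b * v 0 * v 1 + h * v 1 ^ 2) := by
        have : (u * v 0 + b / u * v 1) ^ 2 + (w / u * v 1) ^ 2 =
            u ^ 2 * v 0 ^ 2 + 2 * b * v 0 * v 1 + (b ^ 2 + w ^ 2) / u ^ 2 * v 1 ^ 2 := by
          field_simp
          ring
        rw [this, hw2, hu2, hbR]
        field_simp
        ring
      rw [← e1, hAdef]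
      simp [Fin.sum_univ_three, Matrix.mulVec, dotProduct]
      ring
    rw [key, mul_pow, ht2, hw2] at hv
    exact_mod_cast hv

/-- Descent: modulo p the form is e² + (ry)², and -1 is not a square, so p ∣ N forces p to divide
both e and y, and p² can be divided out. -/
theorem even_padicValNat_of_eq_sq_add_mul_sq {p : ℕ} [Fact p.Prime] (hp4 : p % 4 = 3) {m r : ℤ}
    (hm : (m : ZMod p) = (r : ZMod p) ^ 2) (hr : (r : ZMod p) ≠ 0) (N : ℕ) :
    ∀ e y : ℤ, (N : ℤ) = e ^ 2 + m * y ^ 2 → Even (padicValNat p N) := by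
  have hp : p.Prime := Fact.out
  induction N using Nat.strong_induction_on with
  | _ N ih =>
    intro e y hN
    rcases Nat.eq_zero_or_pos N with rfl | hpos
    · simp
    by_cases hdvd : p ∣ N
    swap
    · simp [padicValNat.eq_zero_of_not_dvd hdvd]
    have h0 : (e : ZMod p) ^ 2 = -((r : ZMod p) * y) ^ 2 := by
      have h1 : ((N : ℤ) : ZMod p) = 0 := by
        rw [Int.cast_natCast]; exact (ZMod.natCast_eq_zero_iff N p).mpr hdvd
      rw [hN] at h1
      push_cast at h1
      rw [hm] at h1
      linear_combination h1
    have hry : (r : ZMod p) * y = 0 := by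
      by_contra hne
      exact ZMod.mod_four_ne_three_of_sq_eq_neg_sq' hne h0 hp4
    have hy : (y : ZMod p) = 0 := (mul_eq_zero.mp hry).resolve_left hr
    have he : (e : ZMod p) = 0 := by
      rw [hry] at h0
      simpa using h0
    obtain ⟨y', rfl⟩ := (ZMod.intCast_zmod_eq_zero_iff_dvd y p).mp hy
    obtain ⟨e', rfl⟩ := (ZMod.intCast_zmod_eq_zero_iff_dvd e p).mp he
    have hdvd2 : p ^ 2 ∣ N := by
      have : ((p ^ 2 : ℕ) : ℤ) ∣ N := ⟨e' ^ 2 + m * y' ^ 2, by rw [hN]; push_cast; ring⟩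
      exact_mod_cast this
    obtain ⟨N', rfl⟩ := hdvd2
    have hN'0 : N' ≠ 0 := by rintro rfl; simp at hpos
    have hlt : N' < p ^ 2 * N' := by
      have : 1 < p ^ 2 := Nat.one_lt_pow (by norm_num) hp.one_lt
      nlinarith [Nat.pos_of_ne_zero hN'0]
    have hN' : (N' : ℤ) = e' ^ 2 + m * y' ^ 2 := by
      have hpz : ((p : ℤ) ^ 2) ≠ 0 := pow_ne_zero _ (by exact_mod_cast hp.ne_zero)
      apply mul_left_cancel₀ hpz
      push_cast at hN
      rw [hN]; ring
    have hev := ih N' hlt e' y' hN'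
    rw [padicValNat.mul (pow_ne_zero _ hp.ne_zero) hN'0, padicValNat.prime_pow]
    exact even_two.add hev

/-- Dirichlet's theorem provides q ≡ 1 mod 4 with -2q ≡ 1 mod m. Since (-2/m) = 1 for m ≡ 3 mod 8,
this gives (q/m) = 1, and reciprocity turns it into (-m/q) = 1. -/
theorem exists_prime_isSquare_neg {m : ℕ} (hm : m % 8 = 3) :
    ∃ q : ℕ, q.Prime ∧ q % 4 = 1 ∧ (m : ℤ) ∣ 2 * q + 1 ∧ IsSquare (-(m : ZMod q)) := by
  have hcop : Nat.Coprime 4 m := by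
    rw [Nat.coprime_comm, show (4 : ℕ) = 2 ^ 2 by norm_num]
    exact Nat.Coprime.pow_right _ (Nat.coprime_two_right.mpr (Nat.odd_iff.mpr (by omega)))
  obtain ⟨a, ha1, ha2⟩ := Nat.chineseRemainder hcop 1 ((m - 1) / 2)
  have ha : 2 * a + 1 ≡ 0 [MOD m] := by
    have h := (ha2.mul_left 2).add_right 1
    rw [show 2 * ((m - 1) / 2) + 1 = m by omega] at h
    exact h.trans (by simp [Nat.ModEq])
  have hacop : a.Coprime (4 * m) := by
    apply Nat.Coprime.mul_right
    · have := ha1.gcd_eq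
      rw [Nat.Coprime, this]; norm_num
    · have hd : m ∣ 2 * a + 1 := (Nat.modEq_zero_iff_dvd).mp ha
      have h1 : Nat.Coprime a (2 * a + 1) := by simp
      exact h1.coprime_dvd_right hd
  obtain ⟨q, hqgt, hqp, hqa⟩ := Nat.forall_exists_prime_gt_and_modEq 2 (q := 4 * m) (a := a)
    (by omega) hacop
  have hq4 : q % 4 = 1 := by
    have : q ≡ 1 [MOD 4] := (hqa.of_mul_right m).trans ha1
    simpa [Nat.ModEq] using this
  have hqm : q ≡ a [MOD m] := hqa.of_mul_left 4
  have hdvd : m ∣ 2 * q + 1 :=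
    (Nat.modEq_zero_iff_dvd).mp (((hqm.mul_left 2).add_right 1).trans ha)
  have hdvdZ : (m : ℤ) ∣ 2 * q + 1 := by exact_mod_cast hdvd
  refine ⟨q, hqp, hq4, hdvdZ, ?_⟩
  have : Fact q.Prime := ⟨hqp⟩
  have hmodd : Odd m := Nat.odd_iff.mpr (by omega)
  have j1 : jacobiSym (-2 * q) m = 1 := by
    have : jacobiSym (-2 * q) m = jacobiSym 1 m := by
      apply jacobiSym.mod_left'
      exact Int.ModEq.symm ((Int.modEq_iff_dvd).mpr (by
        obtain ⟨k, hk⟩ := hdvdZ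
        exact ⟨-k, by linear_combination -hk⟩))
    rw [this, jacobiSym.one_left]
  have j2 : jacobiSym (-2) m = 1 := by
    rw [jacobiSym.at_neg_two hmodd]
    have : (m : ZMod 8) = 3 := by
      have := (ZMod.natCast_eq_natCast_iff' m 3 8).mpr (by omega)
      simpa using this
    rw [this]; decide
  have j3 : jacobiSym m q = 1 := by
    rw [jacobiSym.mul_left, j2, one_mul, jacobiSym.quadratic_reciprocity_one_mod_four hq4 hmodd]
      at j1
    exact j1
  have j4 : jacobiSym (-m) q = 1 := by
    rw [jacobiSym.neg _ (Nat.odd_iff.mpr (by omega)), j3, ZMod.χ₄_nat_one_mod_four hq4, one_mul]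
  have := ZMod.isSquare_of_jacobiSym_eq_one j4
  simpa using this

/-- A short vector makes R² + 2v a multiple of m strictly between 0 and 2m, hence m itself. The
two-squares theorem then applies to 2v: primes p ≡ 3 mod 4 occur in it to even powers because 4qv =
e² + my². -/
theorem eq_sum_three_sq_of_squarefree {m : ℕ} (hm : m % 8 = 3) (hs : Squarefree m) :
    ∃ a b c : ℕ, m = a ^ 2 + b ^ 2 + c ^ 2 := by
  obtain ⟨q, hqp, hq4, hdvd, hsq⟩ := exists_prime_isSquare_neg hm
  have : Fact q.Prime := ⟨hqp⟩
  have hqpos : (0 : ℤ) < q := by exact_mod_cast hqp.pos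
  have hmpos : (0 : ℤ) < m := by omega
  obtain ⟨b, h, hb⟩ : ∃ b h : ℤ, b ^ 2 + m = 4 * q * h := by
    obtain ⟨c, hc⟩ := hsq
    obtain ⟨b₀, rfl⟩ := ZMod.intCast_surjective c
    have h0 : (q : ℤ) ∣ b₀ ^ 2 + m := by
      rw [← ZMod.intCast_zmod_eq_zero_iff_dvd]
      push_cast
      linear_combination -hc
    -- An odd root is needed for 4 ∣ b² + m; adding the odd number q changes the parity.
    obtain ⟨b, hbodd, hbq⟩ : ∃ b : ℤ, b % 2 = 1 ∧ (q : ℤ) ∣ b ^ 2 + m := by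
      rcases Int.emod_two_eq_zero_or_one b₀ with h2 | h2
      · refine ⟨b₀ + q, by omega, ?_⟩
        obtain ⟨k, hk⟩ := h0
        exact ⟨k + 2 * b₀ + q, by linear_combination hk⟩
      · exact ⟨b₀, h2, h0⟩
    have h4 : (4 : ℤ) ∣ b ^ 2 + m := by
      obtain ⟨k, hk⟩ : ∃ k, b = 2 * k + 1 := ⟨b / 2, by omega⟩
      have : b ^ 2 = 4 * (k ^ 2 + k) + 1 := by rw [hk]; ring
      omega
    have hcop : IsCoprime (4 : ℤ) q := by
      rw [Int.isCoprime_iff_gcd_eq_one]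
      have : Nat.Coprime q 4 := by
        rw [show (4 : ℕ) = 2 ^ 2 by norm_num]
        exact Nat.Coprime.pow_right _ (Nat.coprime_two_right.mpr (Nat.odd_iff.mpr (by omega)))
      simpa [Int.gcd, Nat.coprime_comm] using this.symm
    obtain ⟨h, hh⟩ := hcop.mul_dvd h4 hbq
    exact ⟨b, h, hh⟩
  obtain ⟨x, y, z, hne, hlt⟩ := exists_int_ternary_lt m q b h hmpos hqpos hb
  set e : ℤ := 2 * q * x + b * y with he
  set R : ℤ := e + m * z with hR
  set v : ℤ := q * x ^ 2 + b * x * y + h * y ^ 2 with hv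
  have hev : e ^ 2 + m * y ^ 2 = 4 * q * v := by
    rw [he, hv]; linear_combination y ^ 2 * hb
  have hv0 : 0 ≤ v := by
    have : 0 ≤ 4 * (q : ℤ) * v := by rw [← hev]; positivity
    exact nonneg_of_mul_nonneg_right this (by positivity)
  have hmdvd : (m : ℤ) ∣ R ^ 2 + 2 * v := by
    obtain ⟨k, hk⟩ := hdvd
    have hc : IsCoprime (m : ℤ) (2 * q) := ⟨k, -1, by linear_combination -hk⟩
    refine hc.dvd_of_dvd_mul_left ⟨k * e ^ 2 + 2 * q * (2 * e * z + m * z ^ 2) + y ^ 2, ?_⟩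
    rw [hR]
    linear_combination -hev + e ^ 2 * hk
  have hpos : 0 < R ^ 2 + 2 * v := by
    rcases (show 0 ≤ R ^ 2 + 2 * v by positivity).lt_or_eq with h1 | h1
    · exact h1
    exfalso
    have hvz : v = 0 := by nlinarith [sq_nonneg R]
    have hRz : R = 0 := by
      have : R ^ 2 = 0 := by rw [hvz] at h1; linarith
      exact pow_eq_zero_iff (by norm_num) |>.mp this
    rw [hvz, mul_zero] at hev
    have hyz : y = 0 := by
      have : y ^ 2 = 0 := by nlinarith [sq_nonneg e, sq_nonneg y]
      exact pow_eq_zero_iff (by norm_num) |>.mp this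
    have hez : e = 0 := by
      have : e ^ 2 = 0 := by rw [hyz] at hev; linarith
      exact pow_eq_zero_iff (by norm_num) |>.mp this
    have hxz : x = 0 := by
      rw [hez, hyz, mul_zero, add_zero] at he
      have := he.symm
      simpa [hqp.ne_zero] using this
    have hzz : z = 0 := by
      rw [hez, hRz, zero_add] at hR
      exact (mul_eq_zero.mp hR.symm).resolve_left hmpos.ne'
    exact hne ⟨hxz, hyz, hzz⟩
  have hmeq : R ^ 2 + 2 * v = m := by
    obtain ⟨k, hk⟩ := hmdvd
    have h1 : k < 2 := by nlinarith
    have h2 : 0 < k := by nlinarith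
    have : k = 1 := by omega
    rw [hk, this, mul_one]
  obtain ⟨V, hV⟩ := Int.eq_ofNat_of_zero_le hv0
  have htwo : ∃ a c : ℕ, 2 * V = a ^ 2 + c ^ 2 := by
    rw [Nat.eq_sq_add_sq_iff]
    intro p hpmem hp4
    obtain ⟨hp, hpd, hne0⟩ := Nat.mem_primeFactors.mp hpmem
    have : Fact p.Prime := ⟨hp⟩
    have hV0 : V ≠ 0 := by rintro rfl; simp at hne0
    have hcop2 : Nat.Coprime p 2 := Nat.coprime_two_right.mpr (Nat.odd_iff.mpr (by omega))
    have hpV : p ∣ V := hcop2.dvd_of_dvd_mul_left hpd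
    have hpvZ : (p : ℤ) ∣ v := by rw [hV]; exact_mod_cast hpV
    have hp2 : ¬ p ∣ 2 := fun hd => by
      have := Nat.le_of_dvd (by norm_num) hd
      interval_cases p <;> simp_all
    have hp2q : ¬ p ∣ 4 * q := by
      rw [hp.dvd_mul, show (4 : ℕ) = 2 * 2 by norm_num, hp.dvd_mul]
      rintro (hd | hd)
      · exact hp2 (hd.elim id id)
      · have := (Nat.prime_dvd_prime_iff_eq hp hqp).mp hd
        omega
    have hval : padicValNat p (2 * V) = padicValNat p (4 * q * V) := by
      rw [padicValNat.mul (by norm_num) hV0, padicValNat.mul (by simp [hqp.ne_zero]) hV0,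
        padicValNat.eq_zero_of_not_dvd hp2, padicValNat.eq_zero_of_not_dvd hp2q]
    have hvz : (v : ZMod p) = 0 := (ZMod.intCast_zmod_eq_zero_iff_dvd v p).mpr hpvZ
    have hmR : (m : ZMod p) = (R : ZMod p) ^ 2 := by
      have := congrArg (Int.cast : ℤ → ZMod p) hmeq
      push_cast at this
      rw [← this, hvz]; ring
    by_cases hRp : (R : ZMod p) = 0
    -- Here p divides m exactly once. Dividing the relation by p gives y² ≡ 2q ≡ -1 mod p,
    -- impossible for p ≡ 3 mod 4.
    · exfalso
      have hpm : p ∣ m := by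
        rw [← ZMod.natCast_eq_zero_iff, hmR, hRp]; ring
      obtain ⟨m', hm'⟩ := hpm
      have hpm' : ¬ p ∣ m' := by
        intro hd
        obtain ⟨k, rfl⟩ := hd
        exact hp.one_lt.ne' (Nat.isUnit_iff.mp (hs p ⟨k, by rw [hm']; ring⟩))
      have hm'0 : (m' : ZMod p) ≠ 0 := by rwa [Ne, ZMod.natCast_eq_zero_iff]
      obtain ⟨R', hR'⟩ := (ZMod.intCast_zmod_eq_zero_iff_dvd R p).mp hRp
      have hpZ : (p : ℤ) ≠ 0 := by exact_mod_cast hp.ne_zero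
      have hmZ : (m : ℤ) = p * m' := by exact_mod_cast hm'
      obtain ⟨e', he'⟩ : (p : ℤ) ∣ e := by
        refine ⟨R' - m' * z, ?_⟩
        linear_combination -hR + hR' - z * hmZ
      have key : (p : ℤ) * (p * (2 * q * R' ^ 2 + e' ^ 2) + m' * y ^ 2 - 2 * q * m') = 0 := by
        have : 2 * q * (R ^ 2 + 2 * v) - 2 * q * m = 0 := by rw [hmeq]; ring
        rw [hR', hmZ] at this
        rw [he', hmZ] at hev
        linear_combination this + hev
      have key2 : p * (2 * q * R' ^ 2 + e' ^ 2) + m' * y ^ 2 - 2 * q * m' = 0 :=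
        (mul_eq_zero.mp key).resolve_left hpZ
      have key3 : (y : ZMod p) ^ 2 = 2 * q := by
        have := congrArg (Int.cast : ℤ → ZMod p) key2
        push_cast at this
        rw [CharP.cast_eq_zero, zero_mul, zero_add] at this
        apply mul_left_cancel₀ hm'0
        linear_combination this
      have key4 : (2 * q : ZMod p) = -1 := by
        have h1 : ((2 * q + 1 : ℤ) : ZMod p) = 0 := by
          rw [ZMod.intCast_zmod_eq_zero_iff_dvd]
          exact (Dvd.intro _ hmZ.symm).trans hdvd
        push_cast at h1
        linear_combination h1
      refine ZMod.mod_four_ne_three_of_sq_eq_neg_sq' (x := (y : ZMod p)) (one_ne_zero) ?_ hp4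
      rw [key3, key4]; ring
    · rw [hval]
      refine even_padicValNat_of_eq_sq_add_mul_sq hp4 (m := m) (r := R) (by simpa using hmR) hRp _
        e y ?_
      rw [hev, hV]
      push_cast; ring
  obtain ⟨a, c, hac⟩ := htwo
  refine ⟨R.natAbs, a, c, ?_⟩
  zify
  rw [sq_abs, ← hmeq, hV]
  have : (2 * V : ℤ) = a ^ 2 + c ^ 2 := by exact_mod_cast hac
  linarith

/-- Gauss: every number congruent to `3` modulo `8` is a sum of three squares. -/
theorem eq_sum_three_sq_of_mod_eight_eq_three {m : ℕ} (hm : m % 8 = 3) :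
    ∃ a b c : ℕ, m = a ^ 2 + b ^ 2 + c ^ 2 := by
  obtain ⟨s, k, rfl, hs⟩ := Nat.sq_mul_squarefree m
  have hs3 : s % 8 = 3 := by
    rw [Nat.mul_mod, Nat.pow_mod] at hm
    have h1 : k % 8 < 8 := Nat.mod_lt _ (by norm_num)
    have h2 : s % 8 < 8 := Nat.mod_lt _ (by norm_num)
    generalize k % 8 = k' at *
    generalize s % 8 = s' at *
    interval_cases k' <;> simp at hm <;> omega
  obtain ⟨a, b, c, h⟩ := eq_sum_three_sq_of_squarefree hs3 hs
  exact ⟨k * a, k * b, k * c, by rw [h]; ring⟩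

/-- Gauss's Eureka theorem: every natural number is a sum of three triangular numbers. -/
theorem exists_sum_three_triangular (N : ℕ) :
    ∃ p q r : ℕ, p ≤ q ∧ q ≤ r ∧ p * (p + 1) + q * (q + 1) + r * (r + 1) = 2 * N := by
  obtain ⟨a, b, c, h⟩ := eq_sum_three_sq_of_mod_eight_eq_three (m := 8 * N + 3) (by omega)
  have hodd : a % 2 = 1 ∧ b % 2 = 1 ∧ c % 2 = 1 := by
    have key (x : ℕ) : x % 2 = 0 ∧ x ^ 2 % 4 = 0 ∨ x % 2 = 1 ∧ x ^ 2 % 4 = 1 := by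
      rcases Nat.even_or_odd' x with ⟨k, rfl | rfl⟩
      · left; ring_nf; omega
      · right; ring_nf; omega
    have := key a
    have := key b
    have := key c
    omega
  obtain ⟨p, hp⟩ : ∃ p, a = 2 * p + 1 := ⟨a / 2, by omega⟩
  obtain ⟨q, hq⟩ : ∃ q, b = 2 * q + 1 := ⟨b / 2, by omega⟩
  obtain ⟨r, hr⟩ : ∃ r, c = 2 * r + 1 := ⟨c / 2, by omega⟩
  have h' : p * (p + 1) + q * (q + 1) + r * (r + 1) = 2 * N := by
    rw [hp, hq, hr] at h
    nlinarith
  rcases le_total p q with h1 | h1 <;> rcases le_total q r with h2 | h2 <;>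
    rcases le_total p r with h3 | h3
  · exact ⟨p, q, r, h1, h2, h'⟩
  · exact ⟨p, q, r, h1, h2, h'⟩
  · exact ⟨p, r, q, h3, h2, by omega⟩
  · exact ⟨r, p, q, h3, h1, by omega⟩
  · exact ⟨q, p, r, h1, h3, by omega⟩
  · exact ⟨q, r, p, h2, h3, by omega⟩
  · exact ⟨r, q, p, h2, h1, by omega⟩
  · exact ⟨r, q, p, h2, h1, by omega⟩

/-! ### Subset sums of intervals -/

open Finset in
/-- The sums of `k` elements of an interval fill an interval. -/
theorem exists_subset_Ioc_sum_eq (p t k s : ℕ) (hk : p + k ≤ t)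
    (h1 : 2 * (k * p) + k * (k + 1) ≤ 2 * s) (h2 : 2 * s + k * k ≤ 2 * (k * t) + k) :
    ∃ X ⊆ Ioc p t, ∑ x ∈ X, x = s := by
  induction t generalizing k s with
  | zero =>
    obtain rfl : k = 0 := by omega
    exact ⟨∅, by simp, by simp; omega⟩
  | succ t ih =>
    rcases Nat.eq_zero_or_pos k with rfl | hkpos
    · exact ⟨∅, by simp, by simp; omega⟩
    -- Use the top element `t + 1` only when `k` elements of the shorter interval cannot reach `s`.
    by_cases hc : p + k ≤ t ∧ 2 * s + k * k ≤ 2 * (k * t) + k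
    · obtain ⟨X, hX, hs⟩ := ih k s hc.1 h1 hc.2
      exact ⟨X, hX.trans (Ioc_subset_Ioc_right t.le_succ), hs⟩
    · obtain ⟨l, rfl⟩ : ∃ l, k = l + 1 := ⟨k - 1, by omega⟩
      have hlow : 2 * (l * p) + l * (l + 1) + 2 * (t + 1) ≤ 2 * s := by
        by_cases hc1 : p + (l + 1) ≤ t
        · have hc2 : 2 * ((l + 1) * t) + (l + 1) < 2 * s + (l + 1) * (l + 1) := by
            by_contra hcon
            exact hc ⟨hc1, by omega⟩
          obtain ⟨e, he⟩ := Nat.even_mul_succ_self l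
          have hc3 : (l + 1) * t + 1 ≤ s + e := by
            have : (l + 1) * (l + 1) = l * (l + 1) + (l + 1) := by ring
            omega
          obtain ⟨d, rfl⟩ := Nat.exists_eq_add_of_le hc1
          nlinarith [Nat.zero_le (l * d)]
        · obtain rfl : t = p + l := by omega
          nlinarith
      obtain ⟨u, rfl⟩ : ∃ u, s = u + (t + 1) := ⟨s - (t + 1), by omega⟩
      obtain ⟨X, hX, hs⟩ := ih l u (by omega) (by omega) (by nlinarith)
      refine ⟨insert (t + 1) X, ?_, ?_⟩
      · intro x hx
        rcases mem_insert.mp hx with rfl | hx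
        · exact mem_Ioc.mpr ⟨by omega, le_rfl⟩
        · exact Ioc_subset_Ioc_right t.le_succ (hX hx)
      · rw [sum_insert (fun h => by have := mem_Ioc.mp (hX h); omega), hs]
        omega

/-- Every number between the sum of the `d` smallest and the sum of all but the `d` smallest
elements of an interval of length `N` is a subset sum. -/
theorem exists_subset_Ioc_sum_eq_of_le (p N d s : ℕ) (hd : p + d * (d + 1) ≤ d * N)
    (h1 : 2 * (d * p) + d * (d + 1) ≤ 2 * s)
    (h2 : 2 * s + 2 * (d * p) + d * (d + 1) ≤ 2 * (N * p) + N * (N + 1)) :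
    ∃ X ⊆ Finset.Ioc p (p + N), ∑ x ∈ X, x = s := by
  -- Take the largest k for which the k smallest elements sum to at most s. The hypothesis `hd` says
  -- that for k = d the range of k-element sums meets or adjoins that of (k+1)-element sums; the
  -- same then holds for d ≤ k ≤ N - 1 - d.
  obtain ⟨k, hkN, hk1, hk2⟩ : ∃ k ≤ N, 2 * (k * p) + k * (k + 1) ≤ 2 * s ∧
      (k < N → 2 * s < 2 * ((k + 1) * p) + (k + 1) * (k + 2)) := by
    refine ⟨Nat.findGreatest (fun k => 2 * (k * p) + k * (k + 1) ≤ 2 * s) N,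
      Nat.findGreatest_le N, ?_, fun h => ?_⟩
    · exact Nat.findGreatest_spec (P := fun k => 2 * (k * p) + k * (k + 1) ≤ 2 * s)
        (Nat.zero_le N) (by simp)
    · have := Nat.findGreatest_is_greatest
        (P := fun k => 2 * (k * p) + k * (k + 1) ≤ 2 * s) (Nat.lt_succ_self _) h
      simpa [Nat.succ_eq_add_one, add_assoc] using this
  refine exists_subset_Ioc_sum_eq p (p + N) k s (by omega) hk1 ?_
  rcases Nat.lt_or_ge N (k + 1 + d) with hlt | hge
  · obtain ⟨j, rfl⟩ := Nat.exists_eq_add_of_le hkN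
    have hj : j ≤ d := by omega
    obtain ⟨i, rfl⟩ := Nat.exists_eq_add_of_le hj
    nlinarith [Nat.zero_le (i * p), Nat.zero_le (i * j)]
  · have hkd : d ≤ k := by
      by_contra hcon
      have := hk2 (by omega)
      obtain ⟨i, rfl⟩ := Nat.exists_eq_add_of_le (show k + 1 ≤ d by omega)
      nlinarith [Nat.zero_le (i * p), Nat.zero_le (i * k)]
    obtain ⟨i, rfl⟩ := Nat.exists_eq_add_of_le hge
    obtain ⟨j, rfl⟩ := Nat.exists_eq_add_of_le hkd
    have hlt := hk2 (by omega)
    obtain ⟨e, he⟩ := Nat.even_mul_succ_self (d + j)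
    have hle : s ≤ (d + j + 1) * p + e + (d + j) := by
      have : (d + j + 1) * (d + j + 2) = (d + j) * (d + j + 1) + 2 * (d + j + 1) := by ring
      omega
    nlinarith [Nat.zero_le (i * j)]

/-! ### Balanced weighings and rearrangement -/

namespace Munchhausen

/-- The weighing that puts every coin on the cup given by the sign of the coefficient that `e`
assigns to its weight. -/
def Weighing.ofCoeff {n : ℕ} (w : Assignment n) (e : ℕ → ℤ) : Weighing n where
  left := Finset.univ.filter fun c => e (w c) = 1
  right := Finset.univ.filter fun c => e (w c) = -1
  disj := by
    rw [Finset.disjoint_filter]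
    intro c _ h1 h2
    rw [h1] at h2
    norm_num at h2

theorem Weighing.ofCoeff_outcome_eq_iff {n : ℕ} (w w' : Assignment n) (e : ℕ → ℤ)
    (he : ∀ k, e k = -1 ∨ e k = 0 ∨ e k = 1) :
    (Weighing.ofCoeff w e).outcome w' = .eq ↔ ∑ c, e (w c) * ((w' c : ℕ) : ℤ) = 0 := by
  have key : ∑ c, e (w c) * ((w' c : ℕ) : ℤ) =
      ((∑ c ∈ (Weighing.ofCoeff w e).left, (w' c : ℕ) : ℕ) : ℤ) -
        ((∑ c ∈ (Weighing.ofCoeff w e).right, (w' c : ℕ) : ℕ) : ℤ) := by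
    simp only [Weighing.ofCoeff, Finset.sum_filter]
    push_cast
    rw [← Finset.sum_sub_distrib]
    refine Finset.sum_congr rfl fun c _ => ?_
    rcases he (w c) with h | h | h <;> simp [h]
  rw [Weighing.outcome, cmp_eq_eq_iff, key, sub_eq_zero, Nat.cast_inj]

theorem sum_assignment {n : ℕ} (w : Assignment n) (e : ℕ → ℤ) :
    ∑ c, e (w c) * ((w c : ℕ) : ℤ) = ∑ k ∈ Finset.Icc 1 n, e k * k := by
  rw [← Finset.sum_coe_sort (Finset.Icc 1 n) fun k => e k * (k : ℤ)]
  exact Equiv.sum_comp w fun k : Finset.Icc 1 n => e k * ((k : ℕ) : ℤ)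

/-- Two balanced weighings demonstrate the heaviest coin if its total coefficient is strictly the
smallest and the total coefficients decrease with the weight. -/
theorem exists_demonstrates_of_coeff {n : ℕ} (hn : 1 ≤ n) (e₁ e₂ : ℕ → ℤ)
    (he₁ : ∀ k, e₁ k = -1 ∨ e₁ k = 0 ∨ e₁ k = 1) (he₂ : ∀ k, e₂ k = -1 ∨ e₂ k = 0 ∨ e₂ k = 1)
    (hanti : ∀ i j, 1 ≤ i → i ≤ j → j ≤ n → e₁ j + e₂ j ≤ e₁ i + e₂ i)
    (hlast : ∀ k, 1 ≤ k → k < n → e₁ n + e₂ n < e₁ k + e₂ k)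
    (hs₁ : ∑ k ∈ Finset.Icc 1 n, e₁ k * k = 0) (hs₂ : ∑ k ∈ Finset.Icc 1 n, e₂ k * k = 0)
    (w : Assignment n) :
    ∃ Ws : List (Weighing n), Ws.length = 2 ∧ ∃ c : Fin n, (w c : ℕ) = n ∧ Demonstrates w Ws c := by
  refine ⟨[.ofCoeff w e₁, .ofCoeff w e₂], rfl, w.symm ⟨n, by simp [hn]⟩, by simp, ?_⟩
  intro w' hw'
  have hb {e : ℕ → ℤ} (he : ∀ k, e k = -1 ∨ e k = 0 ∨ e k = 1)
      (hs : ∑ k ∈ Finset.Icc 1 n, e k * k = 0)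
      (ho : (Weighing.ofCoeff w e).outcome w' = (Weighing.ofCoeff w e).outcome w) :
      ∑ c, e (w c) * ((w' c : ℕ) : ℤ) = 0 := by
    rwa [(Weighing.ofCoeff_outcome_eq_iff w w e he).mpr (by rw [sum_assignment, hs]),
      Weighing.ofCoeff_outcome_eq_iff w w' e he] at ho
  have h₁ := hb he₁ hs₁ (hw' _ (by simp))
  have h₂ := hb he₂ hs₂ (hw' _ (by simp))
  set f : Fin n → ℤ := fun c => e₁ (w c) + e₂ (w c) with hf
  set g : Fin n → ℤ := fun c => ((w c : ℕ) : ℤ) with hg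
  have hfg : Antivary f g := fun i j hij =>
    hanti _ _ (Finset.mem_Icc.mp (w i).2).1 (by simpa [hg] using hij.le)
      (Finset.mem_Icc.mp (w j).2).2
  have heq : ∑ c, f c * g ((w'.trans w.symm) c) = ∑ c, f c * g c := by
    have l : ∑ c, f c * g ((w'.trans w.symm) c) = 0 := by
      simp [hf, hg, add_mul, Finset.sum_add_distrib, h₁, h₂]
    have r : ∑ c, f c * g c = 0 := by
      simp only [hf, hg, add_mul, Finset.sum_add_distrib, sum_assignment, hs₁, hs₂, add_zero]
    rw [l, r]
  have hanti' := hfg.sum_mul_eq_sum_mul_comp_perm_iff.mp heq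
  set c := w.symm ⟨n, by simp [hn]⟩ with hc
  have hwc : (w c : ℕ) = n := by simp [hc]
  set m := w'.symm ⟨n, by simp [hn]⟩ with hm
  have hwm : (w' m : ℕ) = n := by simp [hm]
  by_contra hne
  have hlt : (w' c : ℕ) < n := by
    refine lt_of_le_of_ne (Finset.mem_Icc.mp (w' c).2).2 fun h => hne ?_
    exact Subtype.ext (h.trans hwc.symm)
  have hmn : (w m : ℕ) < n := by
    refine lt_of_le_of_ne (Finset.mem_Icc.mp (w m).2).2 fun h => ?_
    have : m = c := w.injective (Subtype.ext (h.trans hwc.symm))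
    rw [this] at hwm
    omega
  -- By the equality case, the coin m that `w'` makes heaviest has total coefficient at most that of
  -- c, against the strict minimum at c.
  have := hanti' (i := c) (j := m) (by simp [hg, hwm, hlt])
  have h3 := hlast _ (Finset.mem_Icc.mp (w m).2).1 hmn
  simp only [hf, hwc] at this
  omega

end Munchhausen

/-! ### Coefficients built from triangular numbers -/

namespace Munchhausen

theorem two_mul_sum_Icc_ite_le_mul {n p : ℕ} (hp : p ≤ n) :
    2 * ∑ k ∈ Finset.Icc 1 n, (if k ≤ p then 1 else 0 : ℤ) * k = p * (p + 1) := by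
  induction n, hp using Nat.le_induction with
  | base =>
    have : ∑ k ∈ Finset.Icc 1 p, (if k ≤ p then 1 else 0 : ℤ) * k = ∑ k ∈ Finset.Icc 1 p, (k : ℤ) :=
      Finset.sum_congr rfl fun k hk => by simp [(Finset.mem_Icc.mp hk).2]
    rw [this]
    clear this
    induction p with
    | zero => simp
    | succ p ih =>
      rw [Finset.sum_Icc_succ_top (by omega), mul_add, ih]
      push_cast
      ring
  | succ n hn ih =>
    rw [Finset.sum_Icc_succ_top (by omega), mul_add, ih, if_neg (by omega)]
    ring

theorem sum_Icc_ite_eq_mul {n : ℕ} (hn : 1 ≤ n) :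
    ∑ k ∈ Finset.Icc 1 n, (if k = n then 1 else 0 : ℤ) * k = n := by
  simp [hn]

/-- Coins `1, …, p` get total coefficient `2`, coins up to `q` get `1`, coins up to `r` get `0`, and
the heavier ones are negative; `c` distributes the coefficients of the coins between `p` and `n`
over the two weighings. -/
theorem exists_demonstrates_of_triangular {n p q r : ℕ} (hpq : p ≤ q) (hqr : q ≤ r) (hqn : q < n)
    (hrn : r ≤ n) (hsum : p * (p + 1) + q * (q + 1) + r * (r + 1) = n * (n + 1) + 2 * n)
    (c : ℕ → ℤ) (hc : ∀ k, c k = 0 ∨ p < k ∧ k < n ∧ (c k = 1 ∨ c k = -1 ∧ q < k ∧ k ≤ r))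
    (hcs : 2 * ∑ k ∈ Finset.Icc 1 n, c k * k + (if r < n then 2 * (n : ℤ) else 0) = q * (q + 1))
    (w : Assignment n) :
    ∃ Ws : List (Weighing n), Ws.length = 2 ∧ ∃ c : Fin n, (w c : ℕ) = n ∧ Demonstrates w Ws c := by
  have hcn : c n = 0 := by
    rcases hc n with h | h
    · exact h
    · omega
  have hn : 1 ≤ n := by omega
  have hsumZ : (p : ℤ) * (p + 1) + q * (q + 1) + r * (r + 1) = n * (n + 1) + 2 * n := by
    exact_mod_cast hsum
  have hP := two_mul_sum_Icc_ite_le_mul (hpq.trans hqn.le)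
  have hQ := two_mul_sum_Icc_ite_le_mul hqn.le
  have hR := two_mul_sum_Icc_ite_le_mul hrn
  have hN := two_mul_sum_Icc_ite_le_mul (le_refl n)
  have hL := sum_Icc_ite_eq_mul hn
  refine exists_demonstrates_of_coeff hn
    (fun k => (if k ≤ p then 1 else 0) + c k - if r < k ∨ k = n then 1 else 0)
    (fun k => (if k ≤ q then 1 else 0) - c k - if k = n ∧ r < n then 1 else 0) ?_ ?_ ?_ ?_ ?_ ?_ w
  · intro k
    have := hc k
    split_ifs <;> omega
  · intro k
    have := hc k
    split_ifs <;> omega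
  · intro i j _ hij hjn
    have h₁ : (if j ≤ p then 1 else 0 : ℤ) ≤ if i ≤ p then 1 else 0 := by split_ifs <;> omega
    have h₂ : (if j ≤ q then 1 else 0 : ℤ) ≤ if i ≤ q then 1 else 0 := by split_ifs <;> omega
    have h₃ : (if r < i ∨ i = n then 1 else 0 : ℤ) ≤ if r < j ∨ j = n then 1 else 0 := by
      split_ifs <;> omega
    have h₄ : (if i = n ∧ r < n then 1 else 0 : ℤ) ≤ if j = n ∧ r < n then 1 else 0 := by
      split_ifs <;> omega
    linarith
  · intro k _ hkn
    have h₁ : (if n ≤ p then 1 else 0 : ℤ) ≤ if k ≤ p then 1 else 0 := by split_ifs <;> omega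
    have h₂ : (if n ≤ q then 1 else 0 : ℤ) ≤ if k ≤ q then 1 else 0 := by split_ifs <;> omega
    have h₃ : (if r < k ∨ k = n then 1 else 0 : ℤ) + (if k = n ∧ r < n then 1 else 0) <
        (if r < n ∨ n = n then 1 else 0) + if n = n ∧ r < n then 1 else 0 := by
      split_ifs <;> omega
    linarith
  · rcases hrn.lt_or_eq with hlt | rfl
    · rw [if_pos hlt] at hcs
      have : ∑ k ∈ Finset.Icc 1 n,
          ((if k ≤ p then 1 else 0) + c k - if r < k ∨ k = n then 1 else 0) * (k : ℤ) =
          ∑ k ∈ Finset.Icc 1 n, (if k ≤ p then 1 else 0 : ℤ) * k +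
          ∑ k ∈ Finset.Icc 1 n, c k * k +
          ∑ k ∈ Finset.Icc 1 n, (if k ≤ r then 1 else 0 : ℤ) * k -
          ∑ k ∈ Finset.Icc 1 n, (if k ≤ n then 1 else 0 : ℤ) * k := by
        rw [← Finset.sum_add_distrib, ← Finset.sum_add_distrib, ← Finset.sum_sub_distrib]
        refine Finset.sum_congr rfl fun k hk => ?_
        have hk := Finset.mem_Icc.mp hk
        rw [if_pos hk.2]
        by_cases h : k ≤ r
        · simp only [h, show ¬ (r < k ∨ k = n) by omega, if_true, if_false]; ring
        · simp only [h, show r < k ∨ k = n by omega, if_true, if_false]; ring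
      rw [this]
      linarith
    · rw [if_neg (lt_irrefl _)] at hcs
      have : ∑ k ∈ Finset.Icc 1 r,
          ((if k ≤ p then 1 else 0) + c k - if r < k ∨ k = r then 1 else 0) * (k : ℤ) =
          ∑ k ∈ Finset.Icc 1 r, (if k ≤ p then 1 else 0 : ℤ) * k +
          ∑ k ∈ Finset.Icc 1 r, c k * k -
          ∑ k ∈ Finset.Icc 1 r, (if k = r then 1 else 0 : ℤ) * k := by
        rw [← Finset.sum_add_distrib, ← Finset.sum_sub_distrib]
        refine Finset.sum_congr rfl fun k hk => ?_
        have hk := Finset.mem_Icc.mp hk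
        simp only [show ¬ r < k by omega, false_or]
        ring
      rw [this]
      linarith
  · have : ∑ k ∈ Finset.Icc 1 n,
          ((if k ≤ q then 1 else 0) - c k - if k = n ∧ r < n then 1 else 0) * (k : ℤ) =
          ∑ k ∈ Finset.Icc 1 n, (if k ≤ q then 1 else 0 : ℤ) * k -
          ∑ k ∈ Finset.Icc 1 n, c k * k -
          (if r < n then 1 else 0) * ∑ k ∈ Finset.Icc 1 n, (if k = n then 1 else 0 : ℤ) * k := by
      rw [Finset.mul_sum, ← Finset.sum_sub_distrib, ← Finset.sum_sub_distrib]
      refine Finset.sum_congr rfl fun k _ => ?_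
      by_cases h : r < n
      · simp only [h, and_true, if_true]; ring
      · simp only [h, and_false, if_false]; ring
    rw [this, hL]
    split_ifs at hcs ⊢ <;> linarith

/-- Taking c to be the indicator of X leaves one condition: X sums to T_q - n if r < n, and to T_q
if r = n. -/
theorem exists_demonstrates_of_subset {n p q r : ℕ} (hpq : p ≤ q) (hqr : q ≤ r) (hqn : q < n)
    (hrn : r ≤ n) (hsum : p * (p + 1) + q * (q + 1) + r * (r + 1) = n * (n + 1) + 2 * n)
    (X : Finset ℕ) (hX : ∀ x ∈ X, p < x ∧ x < n)
    (hXs : 2 * ∑ x ∈ X, x + (if r < n then 2 * n else 0) = q * (q + 1)) (w : Assignment n) :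
    ∃ Ws : List (Weighing n), Ws.length = 2 ∧ ∃ c : Fin n, (w c : ℕ) = n ∧ Demonstrates w Ws c := by
  refine exists_demonstrates_of_triangular hpq hqr hqn hrn hsum
    (fun k => if k ∈ X then 1 else 0) (fun k => ?_) ?_ w
  · by_cases h : k ∈ X
    · right; simp [h, hX k h]
    · left; simp [h]
  · have : ∑ k ∈ Finset.Icc 1 n, (if k ∈ X then 1 else 0 : ℤ) * k = ((∑ x ∈ X, x : ℕ) : ℤ) := by
      push_cast
      simp only [ite_mul, one_mul, zero_mul]
      rw [← Finset.sum_filter]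
      refine Finset.sum_congr ?_ fun _ _ => rfl
      ext k
      simp only [Finset.mem_filter, Finset.mem_Icc]
      refine ⟨fun h => h.2, fun h => ⟨?_, h⟩⟩
      have := hX k h
      omega
    rw [this]
    exact_mod_cast hXs

/-- This is the case r = n, where X must sum to T_q: take {1, …, q} if p = 0, and the single element
T_q, which is below n, if p > 0. The latter needs p < T_q, which fails for p = q = 1, excluded by n
≥ 3. -/
theorem exists_demonstrates_of_two_triangular {n p q : ℕ} (hn : 3 ≤ n) (hpq : p ≤ q)
    (hsum : p * (p + 1) + q * (q + 1) = 2 * n) (w : Assignment n) :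
    ∃ Ws : List (Weighing n), Ws.length = 2 ∧ ∃ c : Fin n, (w c : ℕ) = n ∧ Demonstrates w Ws c := by
  have hqn : q < n := by
    by_contra hcon
    nlinarith
  obtain ⟨T, hT⟩ := Nat.even_mul_succ_self q
  rcases Nat.eq_zero_or_pos p with rfl | hp
  · refine exists_demonstrates_of_subset hpq hqn.le hqn le_rfl (by omega) (Finset.Icc 1 q)
      (fun x hx => by have := Finset.mem_Icc.mp hx; omega) ?_ w
    have h := two_mul_sum_Icc_ite_le_mul (le_refl q)
    rw [Finset.sum_congr rfl fun k hk => by rw [if_pos (Finset.mem_Icc.mp hk).2, one_mul]] at h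
    rw [if_neg (lt_irrefl _), add_zero]
    zify
    exact h
  · refine exists_demonstrates_of_subset hpq hqn.le hqn le_rfl (by omega) {T}
      (fun x hx => ?_) ?_ w
    · obtain rfl := Finset.mem_singleton.mp hx
      refine ⟨?_, by nlinarith⟩
      by_contra hcon
      have : q ≤ 1 := by nlinarith
      interval_cases q
      · omega
      · interval_cases p
        omega
    · rw [if_neg (lt_irrefl _), Finset.sum_singleton]
      omega

/-- Here r < n, and X with sum T_q - n is sought in the interval from p + 1 to n - 1. The two
hypotheses on d are the overlap condition and the lower bound of the subset-sum lemma; the upper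
bound follows from T_q ≤ T_r. -/
theorem exists_demonstrates_of_subset_sum {n p q r d : ℕ} (hpq : p ≤ q) (hqr : q ≤ r) (hrn : r < n)
    (hsum : p * (p + 1) + q * (q + 1) + r * (r + 1) = n * (n + 1) + 2 * n)
    (hd : p + d * (d + 1) + d * (p + 1) ≤ d * n)
    (hH : 2 * (d * p) + d * (d + 1) + 2 * n ≤ q * (q + 1)) (w : Assignment n) :
    ∃ Ws : List (Weighing n), Ws.length = 2 ∧ ∃ c : Fin n, (w c : ℕ) = n ∧ Demonstrates w Ws c := by
  obtain ⟨T, hT⟩ := Nat.even_mul_succ_self q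
  obtain ⟨N, rfl⟩ : ∃ N, n = p + N + 1 := ⟨n - 1 - p, by omega⟩
  obtain ⟨s, rfl⟩ : ∃ s, T = s + (p + N + 1) := ⟨T - (p + N + 1), by omega⟩
  have hqr2 : q * (q + 1) ≤ r * (r + 1) := Nat.mul_le_mul hqr (by omega)
  obtain ⟨X, hX, hs⟩ := exists_subset_Ioc_sum_eq_of_le p N d s (by nlinarith) (by omega)
    (by nlinarith)
  refine exists_demonstrates_of_subset hpq hqr (by omega) hrn.le hsum X (fun x hx => ?_) ?_ w
  · have := Finset.mem_Ioc.mp (hX hx)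
    omega
  · rw [if_pos hrn, hs]
    omega

/-! ### Case distinction on n -/

theorem exists_demonstrates_of_small {n : ℕ} (hn : 3 ≤ n) (hn' : n ≤ 30) (w : Assignment n) :
    ∃ Ws : List (Weighing n), Ws.length = 2 ∧ ∃ c : Fin n, (w c : ℕ) = n ∧ Demonstrates w Ws c := by
  -- The listed n are not sums of two triangular numbers; for them explicit triples with r < n and d
  -- = 1 work.
  have h : ∀ n < 31, (n < 3 ∨ n ∈ [5, 8, 14, 17, 19, 23, 26]) ∨
      ∃ p < 6, ∃ q < 8, p ≤ q ∧ p * (p + 1) + q * (q + 1) = 2 * n := by decide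
  rcases h n (by omega) with (h | h) | ⟨p, _, q, _, hpq, hs⟩
  · omega
  · have key {p q r : ℕ} (h : p ≤ q ∧ q ≤ r ∧ r < n ∧
        p * (p + 1) + q * (q + 1) + r * (r + 1) = n * (n + 1) + 2 * n ∧
        2 * p + 3 ≤ n ∧ 2 * p + 2 + 2 * n ≤ q * (q + 1)) :=
      exists_demonstrates_of_subset_sum (d := 1) h.1 h.2.1 h.2.2.1 h.2.2.2.1 (by omega) (by omega) w
    simp only [List.mem_cons, List.not_mem_nil, or_false] at h
    rcases h with rfl | rfl | rfl | rfl | rfl | rfl | rfl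
    · exact key (p := 0) (q := 4) (r := 4) (by norm_num)
    · exact key (p := 1) (q := 5) (r := 7) (by norm_num)
    · exact key (p := 0) (q := 7) (r := 13) (by norm_num)
    · exact key (p := 1) (q := 12) (r := 13) (by norm_num)
    · exact key (p := 1) (q := 10) (r := 17) (by norm_num)
    · exact key (p := 1) (q := 9) (r := 22) (by norm_num)
    · exact key (p := 4) (q := 13) (r := 23) (by norm_num)
  · exact exists_demonstrates_of_two_triangular hn hpq hs w

theorem exists_demonstrates_of_large {n : ℕ} (hn : 31 ≤ n) (w : Assignment n) :
    ∃ Ws : List (Weighing n), Ws.length = 2 ∧ ∃ c : Fin n, (w c : ℕ) = n ∧ Demonstrates w Ws c := by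
  obtain ⟨T, hT⟩ := Nat.even_mul_succ_self n
  obtain ⟨p, q, r, hpq, hqr, hsum'⟩ := exists_sum_three_triangular (T + n)
  have hsum : p * (p + 1) + q * (q + 1) + r * (r + 1) = n * (n + 1) + 2 * n := by omega
  have hrn : r ≤ n := by
    by_contra hcon
    have : (n + 1) * (n + 1 + 1) ≤ r * (r + 1) := Nat.mul_le_mul (by omega) (by omega)
    nlinarith
  rcases hrn.eq_or_lt with rfl | hrn
  · exact exists_demonstrates_of_two_triangular (by omega) hpq (by omega) w
  have hpq2 : p * (p + 1) ≤ q * (q + 1) := Nat.mul_le_mul hpq (by omega)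
  have hqr2 : q * (q + 1) ≤ r * (r + 1) := Nat.mul_le_mul hqr (by omega)
  have hrn2 : r * (r + 1) ≤ (n - 1) * n := Nat.mul_le_mul (by omega) (by omega)
  have hnn : (n - 1) * n + 2 * n = n * (n + 1) := by
    obtain ⟨m, rfl⟩ : ∃ m, n = m + 1 := ⟨n - 1, by omega⟩
    rw [Nat.add_sub_cancel]; ring
  have hqn : 2 * n ≤ q * (q + 1) := by omega
  -- The target T_q - n is nonnegative. If it is at most p, it is below every element of (p, n), so
  -- no nonempty X can have this sum.
  rcases Nat.lt_or_ge (q * (q + 1)) (2 * n + 2 * p + 2) with hH | hH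
  · obtain ⟨T', hT'⟩ := Nat.even_mul_succ_self q
    obtain ⟨H, rfl⟩ : ∃ H, T' = n + H := ⟨T' - n, by omega⟩
    have hHp : H ≤ p := by omega
    -- A smaller r would force T_p + T_q ≥ 3n - 1, hence n ≤ 2p + 2, and then T_q ≤ n + p is too
    -- small for q ≥ p.
    have hr : r = n - 1 := by
      by_contra hne
      have h1 : r * (r + 1) ≤ (n - 2) * (n - 1) := Nat.mul_le_mul (by omega) (by omega)
      have h2 : (n - 2) * (n - 1) + 6 * n = n * (n + 1) + 2 * n + 2 := by
        obtain ⟨m, rfl⟩ : ∃ m, n = m + 2 := ⟨n - 2, by omega⟩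
        rw [Nat.add_sub_cancel, show m + 2 - 1 = m + 1 by omega]; ring
      have h3 : n ≤ 2 * p + 2 := by omega
      nlinarith
    have hpq3 : p * (p + 1) + q * (q + 1) = 4 * n := by
      have : r * (r + 1) = (n - 1) * n := by rw [hr, Nat.sub_add_cancel (by omega)]
      omega
    have hlen : p + q + 2 ≤ n := by
      have h8 : 8 ≤ q := by
        by_contra hcon
        have : q ≤ 7 := by omega
        nlinarith
      nlinarith [sq_nonneg ((p : ℤ) - 2)]
    rcases Nat.eq_zero_or_pos H with rfl | hHpos
    · refine exists_demonstrates_of_subset hpq hqr (by omega) hrn.le hsum ∅ (by simp) ?_ w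
      rw [if_pos hrn]
      simp
      omega
    -- A small target H is a difference: coefficient 1 at q + 1 + H and -1 at q + 1. Both weights
    -- are below n because p + q + 2 ≤ n and H ≤ p.
    · refine exists_demonstrates_of_triangular hpq hqr (by omega) hrn.le hsum
        (fun k => (if k = q + 1 + H then 1 else 0) - if k = q + 1 then 1 else 0) (fun k => ?_) ?_ w
      · split_ifs <;> omega
      · rw [if_pos hrn]
        simp only [sub_mul, Finset.sum_sub_distrib, ite_mul, one_mul, zero_mul,
          Finset.sum_ite_eq', Finset.mem_Icc]
        rw [if_pos (by omega), if_pos (by omega)]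
        push_cast
        have : (q : ℤ) * (q + 1) = (n + H) + (n + H) := by exact_mod_cast hT'
        linarith
  -- For d = 1 the overlap condition is 2p + 3 ≤ n. Otherwise p is about n/2 or more, so T_q ≥ T_p
  -- is large enough to start from d = 2.
  · rcases Nat.lt_or_ge n (2 * p + 3) with hp | hp
    · have hp3 : 3 * p + 8 ≤ 2 * n := by
        by_contra hcon
        have : 3 * (p * (p + 1)) ≤ n * (n + 1) + 2 * n := by omega
        nlinarith
      refine exists_demonstrates_of_subset_sum (d := 2) hpq hqr hrn hsum (by omega) ?_ w
      nlinarith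
    · exact exists_demonstrates_of_subset_sum (d := 1) hpq hqr hrn hsum (by omega) (by omega) w

theorem exists_demonstrates_of_two (w : Assignment 2) :
    ∃ Ws : List (Weighing 2), Ws.length = 2 ∧ ∃ c : Fin 2, (w c : ℕ) = 2 ∧ Demonstrates w Ws c := by
  set c := w.symm ⟨2, by simp⟩ with hc
  set d := w.symm ⟨1, by simp⟩ with hd
  have hne : d ≠ c := by simp [hc, hd]
  let W : Weighing 2 := ⟨{d}, {c}, by simpa using hne⟩
  refine ⟨[W, W], rfl, c, by simp [hc], fun w' hw' => ?_⟩
  have h := hw' W (by simp)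
  have hW : W.outcome w = .lt := by
    rw [Weighing.outcome, cmp_eq_lt_iff]
    simp [W, hc, hd]
  rw [hW, Weighing.outcome, cmp_eq_lt_iff] at h
  simp only [W, Finset.sum_singleton] at h
  have h1 := Finset.mem_Icc.mp (w' c).2
  have h2 := Finset.mem_Icc.mp (w' d).2
  apply Subtype.ext
  simp only [hc, Equiv.apply_symm_apply]
  simp only [← hc]
  omega

theorem exists_demonstrates {n : ℕ} (hn : 1 ≤ n) (w : Assignment n) :
    ∃ Ws : List (Weighing n), Ws.length = 2 ∧ ∃ c : Fin n, (w c : ℕ) = n ∧ Demonstrates w Ws c := by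
  rcases Nat.lt_or_ge 30 n with h | h
  · exact exists_demonstrates_of_large h w
  rcases Nat.lt_or_ge 2 n with h3 | h3
  · exact exists_demonstrates_of_small h3 h w
  interval_cases n
  · refine exists_demonstrates_of_coeff le_rfl (fun _ => 0) (fun _ => 0) (by simp) (by simp)
      (by simp) (fun k _ _ => by omega) (by simp) (by simp) w
  · exact exists_demonstrates_of_two w

end Munchhausen

theorem theorem2 (n : ℕ) (hn : 1 ≤ n) :
    Munchhausen.a n ≤ 2 ∧
      ∀ w : Munchhausen.Assignment n, ∃ Ws : List (Munchhausen.Weighing n), Ws.length ≤ 2 ∧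
        ∃ c : Fin n, (w c : ℕ) = n ∧ Munchhausen.Demonstrates w Ws c := by
  refine ⟨iInf₂_le_of_le 2 (fun w => ?_) le_rfl, fun w => ?_⟩
  · obtain ⟨Ws, hl, c, -, hc⟩ := Munchhausen.exists_demonstrates hn w
    exact ⟨Ws, hl, c, hc⟩
  · obtain ⟨Ws, hl, c, hc⟩ := Munchhausen.exists_demonstrates hn w
    exact ⟨Ws, hl.le, c, hc⟩
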